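/- All graphs are finite, simple, undirected and connected. For a vertex $v$ and a nonempty set $S$ of vertices of a graph $G$, let $d(v,S)=\min\{d(v,w): w\in S\}$. A partition $\Pi=\{S_1,\dots,S_k\}$ of $V(G)$ into nonempty parts is *resolving* if for any two distinct vertices $u,v$ there is some $j$ with $d(u,S_j)\ne d(v,S_j)$, and *dominating* if for every vertex $v$ there is some $j$ with $d(v,S_j)=1$. The dominating partition dimension $\eta_p(G)$ is the minimum number of parts of a partition of $V(G)$ that is both resolving and dominating. Write $+$ for the disjoint union and $\vee$ for the join of graphs, and $\overline{H}$ for the complement of $H$. Theorem. Let $G$ be a connected graph of order $n\ge 6$. Then (1) $\eta_p(G)=n$ if and only if $G$ is isomorphic to the complete graph $K_n$ or to the star $K_{1,n-1}$; (2) $\eta_p(G)=n-1$ if and only if $G$ is isomorphic to the complete split graph $K_{n-2}\vee\overline{K_2}$ or to the graph $K_1\vee(K_1+K_{n-2})$. -/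

import Mathlib

namespace SimpleGraph

/-- The join of two graphs on disjoint vertex sets: the disjoint union of the two graphs together
with all edges between a vertex of the first and a vertex of the second. -/
def graphJoin {V W : Type*} (G : SimpleGraph V) (H : SimpleGraph W) : SimpleGraph (V ⊕ W) :=
  (G ⊕g H) ⊔ completeBipartiteGraph V W

/-- The distance `d(v, S) = min {d(v, w) : w ∈ S}` from a vertex to a set of vertices. -/
noncomputable def distToSet {V : Type*} (G : SimpleGraph V) (v : V) (S : Finset V) : ℕ∞ :=
  ⨅ w ∈ S, G.edist v w

section Partitions

variable {V : Type*} [Fintype V] [DecidableEq V]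

/-- A partition of the vertex set is resolving if any two distinct vertices are at different
distances from some part. -/
def IsResolvingPartition (G : SimpleGraph V) (P : Finpartition (Finset.univ : Finset V)) : Prop :=
  ∀ u v : V, u ≠ v → ∃ S ∈ P.parts, G.distToSet u S ≠ G.distToSet v S

/-- A partition of the vertex set is dominating if every vertex is at distance one from some
part. -/
def IsDominatingPartition (G : SimpleGraph V) (P : Finpartition (Finset.univ : Finset V)) : Prop :=
  ∀ v : V, ∃ S ∈ P.parts, G.distToSet v S = 1

/-- A resolving dominating partition (RD-partition). -/
def IsRDPartition (G : SimpleGraph V) (P : Finpartition (Finset.univ : Finset V)) : Prop :=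
  G.IsResolvingPartition P ∧ G.IsDominatingPartition P

/-- The dominating partition dimension: the minimum number of parts of an RD-partition. (By
`exists_isRDPartition` below, the minimum is over a nonempty set for every nontrivial connected
graph.) -/
noncomputable def domPartitionDim (G : SimpleGraph V) : ℕ :=
  sInf {k : ℕ | ∃ P : Finpartition (Finset.univ : Finset V), G.IsRDPartition P ∧ P.parts.card = k}

/-- In a nontrivial connected graph the partition into singletons is an RD-partition. -/
theorem exists_isRDPartition [Nontrivial V] (G : SimpleGraph V) (hG : G.Connected) :
    ∃ P : Finpartition (Finset.univ : Finset V), G.IsRDPartition P := by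
  refine ⟨⊥, ?_, ?_⟩
  · intro u v huv
    refine ⟨{u}, by simp, ?_⟩
    have h : G.edist v u ≠ 0 := fun h => huv (G.edist_eq_zero_iff.mp h).symm
    simpa [distToSet] using h.symm
  · intro v
    obtain ⟨w, hw⟩ := hG.preconnected.exists_adj_of_nontrivial v
    exact ⟨{w}, by simp, by simpa [distToSet] using hw⟩

end Partitions

end SimpleGraph

/-! Call a graph contractible if two disjoint pairs, or one triple, of vertices can be merged so
that the resulting partition resolves and dominates using adjacency alone; then `domPartitionDim` is
at most n - 2. Unlike distances, adjacency is unchanged on passing from an induced subgraph to the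
whole graph, so contractibility is inherited upwards (`Contractible.map`).

A connected graph of order at least 5 is contractible or belongs to one of four families: complete,
star, complete minus an edge, complete with a pendant vertex
(`Connected.contractible_or_exceptionalOn`). This is shown by growing a connected induced subgraph.
On five vertices it is a finite check, and a vertex attached to an exceptional subgraph of order at
least 5 either creates a contraction or keeps the subgraph exceptional (`ExceptionalOn.insert`).

Each of the four families has a universal vertex, so only adjacency matters and twins lie in
different parts. This gives the value n for the first two families and n - 1 for the last two. As n,
n - 1 and "at most n - 2" exclude each other, both characterizations follow. -/

namespace SimpleGraph

/-! ### Distances to sets, and their collapse to 0, 1, 2 under a universal vertex -/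

section Distance

variable {V : Type*} {G : SimpleGraph V}

theorem distToSet_of_mem {v : V} {S : Finset V} (h : v ∈ S) : G.distToSet v S = 0 := by
  refine le_antisymm ?_ bot_le
  exact (iInf₂_le v h).trans (by simp)

theorem one_le_distToSet {v : V} {S : Finset V} (h : v ∉ S) : 1 ≤ G.distToSet v S := by
  refine le_iInf₂ fun w hw => ?_
  rw [Order.one_le_iff_ne_zero]
  exact fun h0 => h (G.edist_eq_zero_iff.mp h0 ▸ hw)

theorem distToSet_eq_one_of_adj {v w : V} {S : Finset V} (h : v ∉ S) (hw : w ∈ S)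
    (hvw : G.Adj v w) : G.distToSet v S = 1 :=
  le_antisymm ((iInf₂_le w hw).trans (edist_eq_one_iff_adj.mpr hvw).le) (one_le_distToSet h)

theorem two_le_distToSet {v : V} {S : Finset V} (h : v ∉ S) (hS : ∀ w ∈ S, ¬ G.Adj v w) :
    2 ≤ G.distToSet v S := by
  refine le_iInf₂ fun w hw => ?_
  have h0 : G.edist v w ≠ 0 := fun h0 => h (G.edist_eq_zero_iff.mp h0 ▸ hw)
  have h1 : G.edist v w ≠ 1 := fun h1 => hS w hw (edist_eq_one_iff_adj.mp h1)
  have h2 : (1 : ℕ∞) < G.edist v w :=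
    lt_of_le_of_ne (Order.one_le_iff_ne_zero.mpr h0) (Ne.symm h1)
  have := Order.add_one_le_of_lt h2
  rwa [one_add_one_eq_two] at this

theorem distToSet_eq_one_iff {v : V} {S : Finset V} :
    G.distToSet v S = 1 ↔ v ∉ S ∧ ∃ w ∈ S, G.Adj v w := by
  constructor
  · intro h
    have hv : v ∉ S := fun hv => by simp [distToSet_of_mem hv] at h
    refine ⟨hv, ?_⟩
    by_contra! hS
    have := two_le_distToSet hv hS
    rw [h] at this
    exact absurd this (by decide)
  · rintro ⟨hv, w, hw, h⟩
    exact distToSet_eq_one_of_adj hv hw h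

/-- With a universal vertex all distances are at most two. -/
theorem edist_le_two_of_universal {c : V} (hc : ∀ v, v ≠ c → G.Adj v c) (u v : V) :
    G.edist u v ≤ 2 := by
  have key : ∀ x, G.edist x c ≤ 1 := fun x => by
    by_cases h : x = c
    · simp [h]
    · exact (edist_eq_one_iff_adj.mpr (hc x h)).le
  calc G.edist u v ≤ G.edist u c + G.edist c v := G.edist_triangle
    _ ≤ 1 + 1 := add_le_add (key u) (G.edist_comm (u := c) ▸ key v)
    _ = 2 := one_add_one_eq_two

theorem distToSet_eq_two_of_universal {c : V} (hc : ∀ v, v ≠ c → G.Adj v c) {v : V}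
    {S : Finset V} (hne : S.Nonempty) (h : v ∉ S) (hS : ∀ w ∈ S, ¬ G.Adj v w) :
    G.distToSet v S = 2 := by
  obtain ⟨w, hw⟩ := hne
  exact le_antisymm ((iInf₂_le w hw).trans (edist_le_two_of_universal hc v w))
    (two_le_distToSet h hS)

end Distance

/-! ### Bounds on the dimension from colourings and from twins -/

section Partitions

variable {V : Type*} [Fintype V] [DecidableEq V] {G : SimpleGraph V}

theorem domPartitionDim_le_card_parts {P : Finpartition (Finset.univ : Finset V)}
    (hP : G.IsRDPartition P) : G.domPartitionDim ≤ P.parts.card :=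
  Nat.sInf_le ⟨P, hP, rfl⟩

theorem le_domPartitionDim [Nontrivial V] (hG : G.Connected) {k : ℕ}
    (h : ∀ P : Finpartition (Finset.univ : Finset V), G.IsRDPartition P → k ≤ P.parts.card) :
    k ≤ G.domPartitionDim := by
  obtain ⟨P, hP⟩ := exists_isRDPartition G hG
  refine le_csInf ⟨_, P, hP, rfl⟩ ?_
  rintro _ ⟨Q, hQ, rfl⟩
  exact h Q hQ

/-- The colour classes of a colouring in which adjacency to the other classes separates vertices
of equal colour, and every vertex has a neighbour of another colour, form an RD-partition. -/
theorem domPartitionDim_le_card_image {α : Type*} [DecidableEq α] (f : V → α)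
    (hres : ∀ u v, u ≠ v → f u = f v → ∃ w, f w ≠ f u ∧
      ¬ ((∃ x, f x = f w ∧ G.Adj u x) ↔ ∃ x, f x = f w ∧ G.Adj v x))
    (hdom : ∀ u, ∃ w, f w ≠ f u ∧ G.Adj u w) :
    G.domPartitionDim ≤ (Finset.univ.image f).card := by
  classical
  let P := Finpartition.ofSetoid (Setoid.ker f)
  have hmem : ∀ w, Finset.univ.filter (fun x => f w = f x) ∈ P.parts := fun w => by
    exact Finset.mem_image_of_mem _ (Finset.mem_univ w)
  have hcard : P.parts.card ≤ (Finset.univ.image f).card := by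
    have : P.parts = (Finset.univ.image f).image fun y => Finset.univ.filter fun x => y = f x := by
      simp only [P, Finpartition.ofSetoid, Finset.image_image]
      rfl
    rw [this]
    exact Finset.card_image_le
  refine (domPartitionDim_le_card_parts (P := P) ⟨?_, ?_⟩).trans hcard
  · intro u v huv
    by_cases hf : f u = f v
    · obtain ⟨w, hw, h⟩ := hres u v huv hf
      refine ⟨_, hmem w, fun heq => h ?_⟩
      have hu := distToSet_eq_one_iff (G := G) (v := u) (S := Finset.univ.filter fun x => f w = f x)
      have hv := distToSet_eq_one_iff (G := G) (v := v) (S := Finset.univ.filter fun x => f w = f x)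
      rw [heq, hv] at hu
      simpa [hw, hf ▸ hw, eq_comm] using hu.symm
    · refine ⟨_, hmem u, ?_⟩
      rw [distToSet_of_mem (by simp)]
      intro h
      have := one_le_distToSet (G := G) (v := v) (S := Finset.univ.filter fun x => f u = f x)
        (by simpa using hf)
      rw [← h] at this
      simp at this
  · intro v
    obtain ⟨w, hw, h⟩ := hdom v
    exact ⟨_, hmem w, distToSet_eq_one_of_adj (w := w) (by simpa using hw) (by simp) h⟩

theorem domPartitionDim_le_card (hG : G.Connected) [Nontrivial V] :
    G.domPartitionDim ≤ Fintype.card V := by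
  have := domPartitionDim_le_card_image (G := G) (f := id) (fun u v h h' => absurd h' h) fun u => by
    obtain ⟨w, hw⟩ := hG.preconnected.exists_adj_of_nontrivial u
    exact ⟨w, hw.ne', hw⟩
  simpa using this

/-- In a graph with a universal vertex, distances to the parts of an RD-partition are decided by
adjacency, so some other part distinguishes two vertices of a part by adjacency. -/
theorem IsRDPartition.exists_part_of_universal {P : Finpartition (Finset.univ : Finset V)}
    (hP : G.IsRDPartition P) {c : V} (hc : ∀ v, v ≠ c → G.Adj v c) {u v : V} (huv : u ≠ v)
    (h : P.part u = P.part v) :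
    ∃ S ∈ P.parts, u ∉ S ∧ v ∉ S ∧ ¬ ((∃ w ∈ S, G.Adj u w) ↔ ∃ w ∈ S, G.Adj v w) := by
  obtain ⟨S, hS, hne⟩ := hP.1 u v huv
  have hmem : u ∈ S ↔ v ∈ S := by
    rw [← P.part_eq_iff_mem hS, ← P.part_eq_iff_mem hS, h]
  by_cases hu : u ∈ S
  · exact absurd (by rw [distToSet_of_mem hu, distToSet_of_mem (hmem.mp hu)]) hne
  have hv : v ∉ S := fun hv => hu (hmem.mpr hv)
  refine ⟨S, hS, hu, hv, fun hiff => hne ?_⟩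
  by_cases hw : ∃ w ∈ S, G.Adj u w
  · rw [distToSet_eq_one_iff.mpr ⟨hu, hw⟩, distToSet_eq_one_iff.mpr ⟨hv, hiff.mp hw⟩]
  · have hw' : ¬ ∃ w ∈ S, G.Adj v w := fun h => hw (hiff.mpr h)
    push Not at hw hw'
    rw [distToSet_eq_two_of_universal hc (P.nonempty_of_mem_parts hS) hu hw,
      distToSet_eq_two_of_universal hc (P.nonempty_of_mem_parts hS) hv hw']

/-- If twins shared a part, a part separating them would contain neither, and on such a part their
adjacencies agree. -/
theorem IsRDPartition.part_ne_of_twins {P : Finpartition (Finset.univ : Finset V)}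
    (hP : G.IsRDPartition P) {c : V} (hc : ∀ v, v ≠ c → G.Adj v c) {u v : V} (huv : u ≠ v)
    (h : ∀ w, w ≠ u → w ≠ v → (G.Adj u w ↔ G.Adj v w)) : P.part u ≠ P.part v := by
  intro hp
  obtain ⟨S, -, hu, hv, hS⟩ := hP.exists_part_of_universal hc huv hp
  refine hS (exists_congr fun w => and_congr_right fun hw => h w ?_ ?_)
  · rintro rfl; exact hu hw
  · rintro rfl; exact hv hw

theorem IsRDPartition.exists_adj_part_ne {P : Finpartition (Finset.univ : Finset V)}
    (hP : G.IsRDPartition P) (v : V) : ∃ w, P.part w ≠ P.part v ∧ G.Adj v w := by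
  obtain ⟨S, hS, h⟩ := hP.2 v
  obtain ⟨hv, w, hw, hvw⟩ := distToSet_eq_one_iff.mp h
  refine ⟨w, fun heq => hv ?_, hvw⟩
  rw [P.part_eq_of_mem hS hw] at heq
  rw [heq]
  exact P.mem_part (Finset.mem_univ v)

theorem card_le_card_parts_of_injOn (P : Finpartition (Finset.univ : Finset V)) {T : Finset V}
    (h : ∀ u ∈ T, ∀ v ∈ T, u ≠ v → P.part u ≠ P.part v) : T.card ≤ P.parts.card :=
  Finset.card_le_card_of_injOn P.part (fun v _ => P.part_mem.mpr (Finset.mem_univ v))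
    fun u hu v hv huv => by_contra fun hne => h u hu v hv hne huv

end Partitions

/-! ### Merging two pairs or a triple -/

section Contraction

variable {V W : Type*}

/-- Merging the disjoint pairs `{a, b}` and `{c, d}` separates `a` from `b` by adjacency. -/
def PairSeparated (G : SimpleGraph V) (a b c d : V) : Prop :=
  (∃ w, w ≠ a ∧ w ≠ b ∧ w ≠ c ∧ w ≠ d ∧ ¬ (G.Adj a w ↔ G.Adj b w)) ∨
    ¬ ((G.Adj a c ∨ G.Adj a d) ↔ (G.Adj b c ∨ G.Adj b d))

/-- The partition with parts `{a, b}`, `{c, d}` and singletons is resolving and dominating, already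
by adjacency. -/
def TwoPairs (G : SimpleGraph V) (a b c d : V) : Prop :=
  (a ≠ b ∧ a ≠ c ∧ a ≠ d ∧ b ≠ c ∧ b ≠ d ∧ c ≠ d) ∧
  G.PairSeparated a b c d ∧ G.PairSeparated c d a b ∧
  (∃ w, w ≠ b ∧ G.Adj a w) ∧ (∃ w, w ≠ a ∧ G.Adj b w) ∧
  (∃ w, w ≠ d ∧ G.Adj c w) ∧ (∃ w, w ≠ c ∧ G.Adj d w)

/-- The partition with the part `{a, b, c}` and singletons is resolving and dominating, already by
adjacency. -/
def Triple (G : SimpleGraph V) (a b c : V) : Prop :=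
  (a ≠ b ∧ a ≠ c ∧ b ≠ c) ∧
  (∃ w, w ≠ a ∧ w ≠ b ∧ w ≠ c ∧ ¬ (G.Adj a w ↔ G.Adj b w)) ∧
  (∃ w, w ≠ a ∧ w ≠ b ∧ w ≠ c ∧ ¬ (G.Adj a w ↔ G.Adj c w)) ∧
  (∃ w, w ≠ a ∧ w ≠ b ∧ w ≠ c ∧ ¬ (G.Adj b w ↔ G.Adj c w)) ∧
  (∃ w, w ≠ b ∧ w ≠ c ∧ G.Adj a w) ∧ (∃ w, w ≠ a ∧ w ≠ c ∧ G.Adj b w) ∧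
  (∃ w, w ≠ a ∧ w ≠ b ∧ G.Adj c w)

/-- Two vertices can be saved in a partition that resolves and dominates by adjacency. -/
def Contractible (G : SimpleGraph V) : Prop :=
  (∃ a b c d, G.TwoPairs a b c d) ∨ ∃ a b c, G.Triple a b c

theorem PairSeparated.map {H : SimpleGraph W} {G : SimpleGraph V} (f : H ↪g G) {a b c d : W}
    (h : H.PairSeparated a b c d) : G.PairSeparated (f a) (f b) (f c) (f d) := by
  rcases h with ⟨w, h⟩ | h
  · exact Or.inl ⟨f w, by simpa [f.injective.eq_iff] using h⟩
  · exact Or.inr (by simpa using h)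

theorem exists_ne_adj_map {H : SimpleGraph W} {G : SimpleGraph V} (f : H ↪g G) {a b : W}
    (h : ∃ w, w ≠ b ∧ H.Adj a w) : ∃ w, w ≠ f b ∧ G.Adj (f a) w := by
  obtain ⟨w, h⟩ := h
  exact ⟨f w, by simpa [f.injective.eq_iff] using h⟩

theorem TwoPairs.map {H : SimpleGraph W} {G : SimpleGraph V} (f : H ↪g G) {a b c d : W}
    (h : H.TwoPairs a b c d) : G.TwoPairs (f a) (f b) (f c) (f d) := by
  obtain ⟨h0, h1, h2, h3, h4, h5, h6⟩ := h
  exact ⟨by simpa [f.injective.eq_iff] using h0, h1.map f, h2.map f, exists_ne_adj_map f h3,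
    exists_ne_adj_map f h4, exists_ne_adj_map f h5, exists_ne_adj_map f h6⟩

theorem Triple.map {H : SimpleGraph W} {G : SimpleGraph V} (f : H ↪g G) {a b c : W}
    (h : H.Triple a b c) : G.Triple (f a) (f b) (f c) := by
  obtain ⟨h0, ⟨x, hx⟩, ⟨y, hy⟩, ⟨z, hz⟩, ⟨p, hp⟩, ⟨q, hq⟩, ⟨r, hr⟩⟩ := h
  refine ⟨?_, ⟨f x, ?_⟩, ⟨f y, ?_⟩, ⟨f z, ?_⟩, ⟨f p, ?_⟩, ⟨f q, ?_⟩, ⟨f r, ?_⟩⟩ <;>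
    simpa [f.injective.eq_iff]

/-- Every condition is the existence of, or a comparison between, adjacencies among named vertices,
so an induced embedding carries it along. -/
theorem Contractible.map {H : SimpleGraph W} {G : SimpleGraph V} (f : H ↪g G)
    (h : H.Contractible) : G.Contractible := by
  rcases h with ⟨a, b, c, d, h⟩ | ⟨a, b, c, h⟩
  · exact Or.inl ⟨_, _, _, _, h.map f⟩
  · exact Or.inr ⟨_, _, _, h.map f⟩

variable [Fintype V] [DecidableEq V] {G : SimpleGraph V}

theorem card_image_le_of_two_not_mem {f : V → V} {b d : V} (hbd : b ≠ d)
    (hb : ∀ v, f v ≠ b) (hd : ∀ v, f v ≠ d) :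
    (Finset.univ.image f).card ≤ Fintype.card V - 2 := by
  have h : Finset.univ.image f ⊆ ({b, d} : Finset V)ᶜ := by
    intro y hy
    obtain ⟨v, -, rfl⟩ := Finset.mem_image.mp hy
    simp [hb, hd]
  have := Finset.card_le_card h
  rwa [Finset.card_compl, Finset.card_pair hbd] at this

theorem TwoPairs.domPartitionDim_le (hG : G.Connected) [Nontrivial V] {a b c d : V}
    (h : G.TwoPairs a b c d) : G.domPartitionDim ≤ Fintype.card V - 2 := by
  obtain ⟨⟨hab, hac, had, hbc, hbd, hcd⟩, h1, h2, h3, h4, h5, h6⟩ := h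
  -- The colouring keeps `a` and `c` as representatives of the two pairs, so `b` and `d` drop out of
  -- its image.
  let f : V → V := fun v => if v = b then a else if v = d then c else v
  have fa : f a = a := by simp [f, hab, had]
  have fb : f b = a := by simp [f]
  have fc : f c = c := by simp [f, hbc.symm, hcd]
  have fd : f d = c := by simp [f, hbd.symm]
  have fo : ∀ v, v ≠ b → v ≠ d → f v = v := fun v h h' => by simp [f, h, h']
  have ha : ∀ x, f x = a ↔ x = a ∨ x = b := fun x => by simp only [f]; grind
  have hc : ∀ x, f x = c ↔ x = c ∨ x = d := fun x => by simp only [f]; grind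
  have ho : ∀ w, w ≠ a → w ≠ b → w ≠ c → w ≠ d → ∀ x, f x = w ↔ x = w := fun w _ _ _ _ x => by
    simp only [f]; grind
  refine (domPartitionDim_le_card_image f ?_ ?_).trans
    (card_image_le_of_two_not_mem hbd (fun v => ?_) fun v => ?_)
  · have kab : ∃ w, f w ≠ a ∧
        ¬ ((∃ x, f x = f w ∧ G.Adj a x) ↔ ∃ x, f x = f w ∧ G.Adj b x) := by
      rcases h1 with ⟨w, w1, w2, w3, w4, hw⟩ | h1
      · refine ⟨w, by rwa [fo w w2 w4], ?_⟩
        simpa [fo w w2 w4, ho w w1 w2 w3 w4] using hw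
      · refine ⟨c, by rw [fc]; exact hac.symm, ?_⟩
        simpa [fc, hc, or_and_right, exists_or] using h1
    have kcd : ∃ w, f w ≠ c ∧
        ¬ ((∃ x, f x = f w ∧ G.Adj c x) ↔ ∃ x, f x = f w ∧ G.Adj d x) := by
      rcases h2 with ⟨w, w1, w2, w3, w4, hw⟩ | h2
      · refine ⟨w, by rwa [fo w w4 w2], ?_⟩
        simpa [fo w w4 w2, ho w w3 w4 w1 w2] using hw
      · refine ⟨a, by rw [fa]; exact hac, ?_⟩
        simpa [fa, ha, or_and_right, exists_or] using h2
    intro u v huv hf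
    have : (u = a ∧ v = b) ∨ (u = b ∧ v = a) ∨ (u = c ∧ v = d) ∨ (u = d ∧ v = c) := by
      simp only [f] at hf; grind
    rcases this with ⟨rfl, rfl⟩ | ⟨rfl, rfl⟩ | ⟨rfl, rfl⟩ | ⟨rfl, rfl⟩
    · rwa [fa]
    · rw [fb]; obtain ⟨w, hw, h⟩ := kab; exact ⟨w, hw, fun h' => h h'.symm⟩
    · rwa [fc]
    · rw [fd]; obtain ⟨w, hw, h⟩ := kcd; exact ⟨w, hw, fun h' => h h'.symm⟩
  · intro u
    have key : ∃ w, G.Adj u w ∧ ¬ (u = a ∧ w = b) ∧ ¬ (u = b ∧ w = a) ∧ ¬ (u = c ∧ w = d) ∧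
        ¬ (u = d ∧ w = c) := by
      obtain ⟨w, hw⟩ := hG.preconnected.exists_adj_of_nontrivial u
      grind
    obtain ⟨w, hw, h⟩ := key
    refine ⟨w, ?_, hw⟩
    have := hw.ne
    simp only [f]; grind
  · simp only [f]; grind
  · simp only [f]; grind

theorem Triple.domPartitionDim_le (hG : G.Connected) [Nontrivial V] {a b c : V}
    (h : G.Triple a b c) : G.domPartitionDim ≤ Fintype.card V - 2 := by
  obtain ⟨⟨hab, hac, hbc⟩, h1, h2, h3, h4, h5, h6⟩ := h
  let f : V → V := fun v => if v = b then a else if v = c then a else v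
  have ho : ∀ w, w ≠ a → w ≠ b → w ≠ c → ∀ x, f x = w ↔ x = w := fun w _ _ _ x => by
    simp only [f]; grind
  have fa : ∀ x, f x = a ↔ x = a ∨ x = b ∨ x = c := fun x => by simp only [f]; grind
  refine (domPartitionDim_le_card_image f ?_ ?_).trans
    (card_image_le_of_two_not_mem hbc (fun v => ?_) fun v => ?_)
  · intro u v huv hf
    have huv' : (u = a ∨ u = b ∨ u = c) ∧ (v = a ∨ v = b ∨ v = c) := by
      simp only [f] at hf; grind
    have key : ∃ w, w ≠ a ∧ w ≠ b ∧ w ≠ c ∧ ¬ (G.Adj u w ↔ G.Adj v w) := by grind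
    obtain ⟨w, w1, w2, w3, hw⟩ := key
    have fw : f w = w := by simp [f, w2, w3]
    refine ⟨w, ?_, ?_⟩
    · rw [fw, (fa u).mpr huv'.1]; exact w1
    · simpa [fw, ho w w1 w2 w3] using hw
  · intro u
    have key : ∃ w, G.Adj u w ∧ ¬ ((u = a ∨ u = b ∨ u = c) ∧ (w = a ∨ w = b ∨ w = c)) := by
      obtain ⟨w, hw⟩ := hG.preconnected.exists_adj_of_nontrivial u
      by_cases hu : u = a ∨ u = b ∨ u = c
      · obtain ⟨w, hw⟩ := h4
        obtain ⟨x, hx⟩ := h5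
        obtain ⟨y, hy⟩ := h6
        have := hw.2.2.ne
        have := hx.2.2.ne
        have := hy.2.2.ne
        grind
      · exact ⟨w, hw, fun h => hu h.1⟩
    obtain ⟨w, hw, h⟩ := key
    refine ⟨w, ?_, hw⟩
    have := hw.ne
    simp only [f]; grind
  · simp only [f]; grind
  · simp only [f]; grind

theorem Contractible.domPartitionDim_le (hG : G.Connected) [Nontrivial V]
    (h : G.Contractible) : G.domPartitionDim ≤ Fintype.card V - 2 := by
  rcases h with ⟨a, b, c, d, h⟩ | ⟨a, b, c, h⟩
  · exact h.domPartitionDim_le hG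
  · exact h.domPartitionDim_le hG

end Contraction

/-! ### The four exceptional families and their one-vertex extensions -/

section Exceptional

variable {V W : Type*}

/-- `S` induces a complete graph. -/
def CompleteOn (G : SimpleGraph V) (S : Finset V) : Prop :=
  ∀ u ∈ S, ∀ v ∈ S, G.Adj u v ↔ u ≠ v

/-- `S` induces a star with centre `c`. -/
def StarOn (G : SimpleGraph V) (S : Finset V) (c : V) : Prop :=
  c ∈ S ∧ ∀ u ∈ S, ∀ v ∈ S, G.Adj u v ↔ u ≠ v ∧ (u = c ∨ v = c)

/-- `S` induces a complete graph minus the edge `ab`. -/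
def NearCompleteOn (G : SimpleGraph V) (S : Finset V) (a b : V) : Prop :=
  a ∈ S ∧ b ∈ S ∧ a ≠ b ∧
    ∀ u ∈ S, ∀ v ∈ S, G.Adj u v ↔ u ≠ v ∧ ¬ (u = a ∧ v = b) ∧ ¬ (u = b ∧ v = a)

/-- `S` induces a complete graph with a pendant vertex `p` attached at `c`. -/
def PendantOn (G : SimpleGraph V) (S : Finset V) (c p : V) : Prop :=
  c ∈ S ∧ p ∈ S ∧ c ≠ p ∧
    ∀ u ∈ S, ∀ v ∈ S, G.Adj u v ↔ u ≠ v ∧ (u = p → v = c) ∧ (v = p → u = c)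

/-- `S` induces a graph of one of the four exceptional families. -/
def ExceptionalOn (G : SimpleGraph V) (S : Finset V) : Prop :=
  G.CompleteOn S ∨ (∃ c, G.StarOn S c) ∨ (∃ a b, G.NearCompleteOn S a b) ∨
    ∃ c p, G.PendantOn S c p

variable {G : SimpleGraph V}

theorem CompleteOn.map {H : SimpleGraph W} (f : H ↪g G) {S : Finset W} (h : H.CompleteOn S) :
    G.CompleteOn (S.map f.toEmbedding) := by
  simpa [CompleteOn, f.injective.eq_iff] using h

theorem StarOn.map {H : SimpleGraph W} (f : H ↪g G) {S : Finset W} {c : W} (h : H.StarOn S c) :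
    G.StarOn (S.map f.toEmbedding) (f c) := by
  simpa [StarOn, f.injective.eq_iff] using h

theorem NearCompleteOn.map {H : SimpleGraph W} (f : H ↪g G) {S : Finset W} {a b : W}
    (h : H.NearCompleteOn S a b) : G.NearCompleteOn (S.map f.toEmbedding) (f a) (f b) := by
  simpa [NearCompleteOn, f.injective.eq_iff] using h

theorem PendantOn.map {H : SimpleGraph W} (f : H ↪g G) {S : Finset W} {c p : W}
    (h : H.PendantOn S c p) : G.PendantOn (S.map f.toEmbedding) (f c) (f p) := by
  simpa [PendantOn, f.injective.eq_iff] using h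

theorem ExceptionalOn.map {H : SimpleGraph W} (f : H ↪g G) {S : Finset W}
    (h : H.ExceptionalOn S) : G.ExceptionalOn (S.map f.toEmbedding) := by
  rcases h with h | ⟨c, h⟩ | ⟨a, b, h⟩ | ⟨c, p, h⟩
  · exact Or.inl (h.map f)
  · exact Or.inr (Or.inl ⟨_, h.map f⟩)
  · exact Or.inr (Or.inr (Or.inl ⟨_, _, h.map f⟩))
  · exact Or.inr (Or.inr (Or.inr ⟨_, _, h.map f⟩))

theorem exists_mem_ne_of_five_le_card [DecidableEq V] {S : Finset V} (hS : 5 ≤ S.card)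
    (a b c d : V) : ∃ z ∈ S, z ≠ a ∧ z ≠ b ∧ z ≠ c ∧ z ≠ d := by
  have : ({a, b, c, d} : Finset V).card < S.card := lt_of_le_of_lt Finset.card_le_four hS
  obtain ⟨z, hz, hz'⟩ := Finset.exists_mem_notMem_of_card_lt_card this
  exact ⟨z, hz, by simpa using hz'⟩

theorem twoPairs_of_witnesses {a b c d v w x y z t : V}
    (hne : a ≠ b ∧ a ≠ c ∧ a ≠ d ∧ b ≠ c ∧ b ≠ d ∧ c ≠ d)
    (hv : v ≠ a ∧ v ≠ b ∧ v ≠ c ∧ v ≠ d ∧ ¬ (G.Adj a v ↔ G.Adj b v))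
    (hw : w ≠ a ∧ w ≠ b ∧ w ≠ c ∧ w ≠ d ∧ ¬ (G.Adj c w ↔ G.Adj d w))
    (hx : x ≠ b ∧ G.Adj a x) (hy : y ≠ a ∧ G.Adj b y)
    (hz : z ≠ d ∧ G.Adj c z) (ht : t ≠ c ∧ G.Adj d t) : G.Contractible :=
  Or.inl ⟨a, b, c, d, hne, Or.inl ⟨v, hv⟩,
    Or.inl ⟨w, hw.2.2.1, hw.2.2.2.1, hw.1, hw.2.1, hw.2.2.2.2⟩, ⟨x, hx⟩, ⟨y, hy⟩, ⟨z, hz⟩, ⟨t, ht⟩⟩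

variable [DecidableEq V] {S : Finset V} {x y : V}

/-- With two neighbours `y`, `a` and two non-neighbours `b`, `d` in the clique, `x` separates both
pairs `{y, b}` and `{a, d}`. Otherwise `x` has one neighbour (pendant), one non-neighbour
(near-complete) or none (complete). -/
theorem CompleteOn.insert (h : G.CompleteOn S) (hx : x ∉ S) (hy : y ∈ S)
    (hxy : G.Adj x y) : G.Contractible ∨ G.ExceptionalOn (insert x S) := by
  unfold CompleteOn at h
  have hsymm : ∀ u, G.Adj u x ↔ G.Adj x u := fun u => G.adj_comm u x
  by_cases h1 : ∃ a ∈ S, a ≠ y ∧ G.Adj x a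
  · obtain ⟨a, ha, hay, hxa⟩ := h1
    by_cases h2 : ∃ b ∈ S, ¬ G.Adj x b
    · obtain ⟨b, hb, hxb⟩ := h2
      by_cases h3 : ∃ d ∈ S, d ≠ b ∧ ¬ G.Adj x d
      · obtain ⟨d, hd, hdb, hxd⟩ := h3
        left
        apply twoPairs_of_witnesses (a := y) (b := b) (c := a) (d := d) (v := x) (w := x) (x := a)
          (y := a) (z := y) (t := y) <;> grind
      · refine Or.inr (Or.inr (Or.inr (Or.inl ⟨x, b, ?_⟩)))
        unfold NearCompleteOn
        have := G.irrefl (v := x)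
        grind
    · refine Or.inr (Or.inl ?_)
      unfold CompleteOn
      have := G.irrefl (v := x)
      grind
  · refine Or.inr (Or.inr (Or.inr (Or.inr ⟨y, x, ?_⟩)))
    unfold PendantOn
    have := G.irrefl (v := x)
    grind

theorem StarOn.insert {c : V} (h : G.StarOn S c) (hS : 5 ≤ S.card) (hx : x ∉ S) (hy : y ∈ S)
    (hxy : G.Adj x y) : G.Contractible ∨ G.ExceptionalOn (insert x S) := by
  obtain ⟨hc, h⟩ := h
  have hsymm : ∀ u, G.Adj u x ↔ G.Adj x u := fun u => G.adj_comm u x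
  have hirr := G.irrefl (v := x)
  -- Two leaves adjacent to `x` suffice, whether or not `x` sees the centre: `l₃` separates `x` from
  -- a third leaf and `c` from `l₂`.
  have two : ∀ l₂ ∈ S, ∀ l₃ ∈ S, l₂ ≠ c → l₃ ≠ c → l₂ ≠ l₃ → G.Adj x l₂ → G.Adj x l₃ →
      G.Contractible := by
    intro l₂ h₂ l₃ h₃ h₂c h₃c h₂₃ hx₂ hx₃
    obtain ⟨l₁, h₁, hl₁⟩ := exists_mem_ne_of_five_le_card hS c l₂ l₃ c
    apply twoPairs_of_witnesses (a := x) (b := l₁) (c := c) (d := l₂) (v := l₃) (w := l₃) (x := l₃)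
          (y := c) (z := l₃) (t := x) <;> grind
  by_cases hxc : G.Adj x c
  · by_cases h1 : ∃ a ∈ S, a ≠ c ∧ G.Adj x a
    · obtain ⟨a, ha, hac, hxa⟩ := h1
      left
      by_cases h2 : ∃ b ∈ S, b ≠ c ∧ b ≠ a ∧ G.Adj x b
      · obtain ⟨b, hb, hbc, hba, hxb⟩ := h2
        exact two a ha b hb hac hbc hba.symm hxa hxb
      · obtain ⟨l₁, h₁, hl₁⟩ := exists_mem_ne_of_five_le_card hS c a a a
        obtain ⟨l₂, h₂, hl₂⟩ := exists_mem_ne_of_five_le_card hS c a l₁ a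
        -- No outside vertex separates these pairs; the edge `xa` is the only edge between them, so
        -- each pair separates the other.
        refine Or.inl ⟨x, l₁, a, l₂, ?_, Or.inr ?_, Or.inr ?_, ⟨c, ?_⟩, ⟨c, ?_⟩, ⟨c, ?_⟩,
          ⟨c, ?_⟩⟩ <;> grind
    · refine Or.inr (Or.inr (Or.inl ⟨c, ?_⟩))
      unfold StarOn
      grind
  · left
    have hyc : y ≠ c := fun h => hxc (h ▸ hxy)
    by_cases h1 : ∃ b ∈ S, b ≠ c ∧ ¬ G.Adj x b
    · obtain ⟨l₁, h₁, hl₁, hx₁⟩ := h1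
      obtain ⟨l₂, h₂, hl₂⟩ := exists_mem_ne_of_five_le_card hS c y l₁ c
      -- The centre separates `x` from `l₂`, and the pair `{x, l₂}` separates `y` from `l₁` through
      -- the edge `xy`.
      refine Or.inl ⟨x, l₂, y, l₁, ?_, Or.inl ⟨c, ?_⟩, Or.inr ?_, ⟨y, ?_⟩, ⟨c, ?_⟩, ⟨c, ?_⟩,
          ⟨c, ?_⟩⟩ <;> grind
    · obtain ⟨l₁, h₁, hl₁⟩ := exists_mem_ne_of_five_le_card hS c y c c
      exact two y hy l₁ h₁ hyc hl₁.1 hl₁.2.1.symm hxy (by grind)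

/-- A vertex of `{a, b}` is separated from a universal vertex by the other one, and `x` is separated
from a universal vertex by any of its non-neighbours. So `x` must see all of `S`. -/
theorem NearCompleteOn.insert {a b : V} (h : G.NearCompleteOn S a b) (hS : 5 ≤ S.card)
    (hx : x ∉ S) (hy : y ∈ S) (hxy : G.Adj x y) :
    G.Contractible ∨ G.ExceptionalOn (insert x S) := by
  obtain ⟨ha, hb, hab, h⟩ := h
  have hsymm : ∀ u, G.Adj u x ↔ G.Adj x u := fun u => G.adj_comm u x
  have hirr := G.irrefl (v := x)
  by_cases h1 : ∃ z ∈ S, z ≠ a ∧ z ≠ b ∧ ¬ G.Adj x z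
  · obtain ⟨z, hz, hza, hzb, hxz⟩ := h1
    -- Here `q` avoids `y` so that `x`, merged with `q`, keeps the neighbour `y` outside its part.
    obtain ⟨q, hq, hq'⟩ := exists_mem_ne_of_five_le_card hS a b z y
    obtain ⟨r, hr, hr'⟩ := exists_mem_ne_of_five_le_card hS a b z q
    left
    apply twoPairs_of_witnesses (a := a) (b := r) (c := x) (d := q) (v := b) (w := z) (x := q)
      (y := q) (z := y) (t := r) <;> grind
  · obtain ⟨q, hq, hq'⟩ := exists_mem_ne_of_five_le_card hS a b a b
    obtain ⟨r, hr, hr'⟩ := exists_mem_ne_of_five_le_card hS a b q q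
    by_cases hxb : G.Adj x b
    · by_cases hxa : G.Adj x a
      · refine Or.inr (Or.inr (Or.inr (Or.inl ⟨a, b, ?_⟩)))
        unfold NearCompleteOn
        grind
      · left
        apply twoPairs_of_witnesses (a := b) (b := r) (c := x) (d := q) (v := a) (w := a) (x := q)
          (y := q) (z := r) (t := r) <;> grind
    · left
      apply twoPairs_of_witnesses (a := a) (b := r) (c := x) (d := q) (v := b) (w := b) (x := q)
        (y := q) (z := r) (t := r) <;> grind

/-- A clique vertex other than `c` separates `p` from the rest of the clique, and a non-neighbour of
`x` in the clique separates `x` from it. If `x` sees the whole clique and also `p`, then `p`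
separates both `c` and `x` from the others; only a larger pendant graph remains. -/
theorem PendantOn.insert {c p : V} (h : G.PendantOn S c p) (hS : 5 ≤ S.card)
    (hx : x ∉ S) (hy : y ∈ S) (hxy : G.Adj x y) :
    G.Contractible ∨ G.ExceptionalOn (insert x S) := by
  obtain ⟨hc, hp, hcp, h⟩ := h
  have hsymm : ∀ u, G.Adj u x ↔ G.Adj x u := fun u => G.adj_comm u x
  have hirr := G.irrefl (v := x)
  by_cases h1 : ∃ z ∈ S, z ≠ c ∧ z ≠ p ∧ ¬ G.Adj x z
  · obtain ⟨z, hz, hzc, hzp, hxz⟩ := h1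
    obtain ⟨q, hq, hq'⟩ := exists_mem_ne_of_five_le_card hS c p z y
    obtain ⟨r, hr, hr'⟩ := exists_mem_ne_of_five_le_card hS c p z q
    left
    apply twoPairs_of_witnesses (a := p) (b := r) (c := x) (d := q) (v := z) (w := z) (x := c)
      (y := c) (z := y) (t := c) <;> grind
  · obtain ⟨q, hq, hq'⟩ := exists_mem_ne_of_five_le_card hS c p c p
    obtain ⟨r, hr, hr'⟩ := exists_mem_ne_of_five_le_card hS c p q q
    obtain ⟨s, hs, hs'⟩ := exists_mem_ne_of_five_le_card hS c p q r
    by_cases hxc : G.Adj x c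
    · by_cases hxp : G.Adj x p
      · left
        apply twoPairs_of_witnesses (a := c) (b := q) (c := x) (d := r) (v := p) (w := p) (x := x)
          (y := x) (z := c) (t := c) <;> grind
      · refine Or.inr (Or.inr (Or.inr (Or.inr ⟨c, p, ?_⟩)))
        unfold PendantOn
        grind
    · left
      apply twoPairs_of_witnesses (a := p) (b := r) (c := x) (d := q) (v := s) (w := c) (x := c)
        (y := c) (z := r) (t := c) <;> grind

theorem ExceptionalOn.insert (h : G.ExceptionalOn S) (hS : 5 ≤ S.card) (hx : x ∉ S) (hy : y ∈ S)
    (hxy : G.Adj x y) : G.Contractible ∨ G.ExceptionalOn (insert x S) := by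
  rcases h with h | ⟨c, h⟩ | ⟨a, b, h⟩ | ⟨c, p, h⟩
  · exact h.insert hx hy hxy
  · exact h.insert hS hx hy hxy
  · exact h.insert hS hx hy hxy
  · exact h.insert hS hx hy hxy

/-- A set of vertices that is not everything has a neighbour in a connected graph. -/
theorem Connected.exists_adj_notMem [Fintype V] (hG : G.Connected) (hne : S.Nonempty)
    (hS : S ≠ Finset.univ) : ∃ x ∉ S, ∃ y ∈ S, G.Adj x y := by
  obtain ⟨z, hz⟩ : ∃ z, z ∉ S := by
    by_contra! h
    exact hS (Finset.eq_univ_iff_forall.mpr h)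
  obtain ⟨y, hy⟩ := hne
  obtain ⟨d, -, hd, hd'⟩ := (hG.preconnected y z).some.exists_boundary_dart (S : Set V) hy hz
  exact ⟨_, hd', _, hd, d.adj.symm⟩

/-- Induction on the complement of `T`: connectedness supplies an outside vertex adjacent to `T`, to
which `ExceptionalOn.insert` applies. -/
theorem ExceptionalOn.univ_of_connected [Fintype V] (hG : G.Connected) {T : Finset V} (hT : 5 ≤ T.card)
    (h : G.ExceptionalOn T) : G.Contractible ∨ G.ExceptionalOn Finset.univ := by
  by_cases hu : T = Finset.univ
  · exact Or.inr (hu ▸ h)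
  · obtain ⟨x, hx, y, hy, hxy⟩ :=
      hG.exists_adj_notMem (Finset.card_pos.mp (by omega)) hu
    rcases h.insert hT hx hy hxy with h' | h'
    · exact Or.inl h'
    · have hlt : Tᶜ.card > (Insert.insert x T)ᶜ.card :=
        Finset.card_lt_card (Finset.compl_ssubset_compl.mpr (Finset.ssubset_insert hx))
      exact h'.univ_of_connected hG (by rw [Finset.card_insert_of_notMem hx]; omega)
termination_by Tᶜ.card
decreasing_by exact hlt

end Exceptional

/-! ### The base case: five vertices -/

section Five

/-- The graph on five vertices with given adjacencies. -/
def fiveGraph (b₀₁ b₀₂ b₁₂ b₀₃ b₁₃ b₂₃ b₀₄ b₁₄ b₂₄ b₃₄ : Bool) : SimpleGraph (Fin 5) where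
  Adj i j := (match i, j with
    | 0, 1 | 1, 0 => b₀₁
    | 0, 2 | 2, 0 => b₀₂
    | 1, 2 | 2, 1 => b₁₂
    | 0, 3 | 3, 0 => b₀₃
    | 1, 3 | 3, 1 => b₁₃
    | 2, 3 | 3, 2 => b₂₃
    | 0, 4 | 4, 0 => b₀₄
    | 1, 4 | 4, 1 => b₁₄
    | 2, 4 | 4, 2 => b₂₄
    | 3, 4 | 4, 3 => b₃₄
    | _, _ => false) = true
  symm := ⟨fun i j => by fin_cases i <;> fin_cases j <;> exact id⟩
  loopless := ⟨fun i => by fin_cases i <;> simp⟩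

instance (b₀₁ b₀₂ b₁₂ b₀₃ b₁₃ b₂₃ b₀₄ b₁₄ b₂₄ b₃₄ : Bool) :
    DecidableRel (fiveGraph b₀₁ b₀₂ b₁₂ b₀₃ b₁₃ b₂₃ b₀₄ b₁₄ b₂₄ b₃₄).Adj :=
  fun _ _ => inferInstanceAs (Decidable (_ = true))

/-- The instance of `TwoPairs` in which `e` is the only witness outside the two pairs. -/
def TwoPairsWith {V : Type*} (G : SimpleGraph V) (a b c d e : V) : Prop :=
  (¬ (G.Adj a e ↔ G.Adj b e) ∨ ¬ ((G.Adj a c ∨ G.Adj a d) ↔ (G.Adj b c ∨ G.Adj b d))) ∧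
  (¬ (G.Adj c e ↔ G.Adj d e) ∨ ¬ ((G.Adj c a ∨ G.Adj c b) ↔ (G.Adj d a ∨ G.Adj d b))) ∧
  (G.Adj a c ∨ G.Adj a d ∨ G.Adj a e) ∧ (G.Adj b c ∨ G.Adj b d ∨ G.Adj b e) ∧
  (G.Adj c a ∨ G.Adj c b ∨ G.Adj c e) ∧ (G.Adj d a ∨ G.Adj d b ∨ G.Adj d e) ∧
  (a ≠ b ∧ a ≠ c ∧ a ≠ d ∧ b ≠ c ∧ b ≠ d ∧ c ≠ d) ∧ e ≠ a ∧ e ≠ b ∧ e ≠ c ∧ e ≠ d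

/-- The instance of `Triple` in which `d` and `e` are the only witnesses outside the triple. -/
def TripleWith {V : Type*} (G : SimpleGraph V) (a b c d e : V) : Prop :=
  (¬ (G.Adj a d ↔ G.Adj b d) ∨ ¬ (G.Adj a e ↔ G.Adj b e)) ∧
  (¬ (G.Adj a d ↔ G.Adj c d) ∨ ¬ (G.Adj a e ↔ G.Adj c e)) ∧
  (¬ (G.Adj b d ↔ G.Adj c d) ∨ ¬ (G.Adj b e ↔ G.Adj c e)) ∧
  (G.Adj a d ∨ G.Adj a e) ∧ (G.Adj b d ∨ G.Adj b e) ∧ (G.Adj c d ∨ G.Adj c e) ∧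
  (a ≠ b ∧ a ≠ c ∧ b ≠ c) ∧ (d ≠ a ∧ d ≠ b ∧ d ≠ c) ∧ e ≠ a ∧ e ≠ b ∧ e ≠ c

theorem TwoPairsWith.contractible {V : Type*} {G : SimpleGraph V} {a b c d e : V}
    (h : G.TwoPairsWith a b c d e) : G.Contractible := by
  obtain ⟨h1, h2, h3, h4, h5, h6, h7, h8⟩ := h
  refine Or.inl ⟨a, b, c, d, h7, ?_, ?_, ?_, ?_, ?_, ?_⟩
  · exact h1.imp_left fun h => ⟨e, h8.1, h8.2.1, h8.2.2.1, h8.2.2.2, h⟩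
  · exact h2.imp_left fun h => ⟨e, h8.2.2.1, h8.2.2.2, h8.1, h8.2.1, h⟩
  all_goals clear h1 h2
  · rcases h3 with h | h | h <;> exact ⟨_, by grind, h⟩
  · rcases h4 with h | h | h <;> exact ⟨_, by grind, h⟩
  · rcases h5 with h | h | h <;> exact ⟨_, by grind, h⟩
  · rcases h6 with h | h | h <;> exact ⟨_, by grind, h⟩

theorem TripleWith.contractible {V : Type*} {G : SimpleGraph V} {a b c d e : V}
    (h : G.TripleWith a b c d e) : G.Contractible := by
  obtain ⟨h1, h2, h3, h4, h5, h6, h7, h8⟩ := h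
  refine Or.inr ⟨a, b, c, h7, ?_, ?_, ?_, ?_, ?_, ?_⟩ <;> grind

instance {V : Type*} [DecidableEq V] (G : SimpleGraph V) [DecidableRel G.Adj]
    (a b c d e : V) : Decidable (G.TwoPairsWith a b c d e) := by
  unfold TwoPairsWith; infer_instance

instance {V : Type*} [DecidableEq V] (G : SimpleGraph V) [DecidableRel G.Adj]
    (a b c d e : V) : Decidable (G.TripleWith a b c d e) := by
  unfold TripleWith; infer_instance

instance {V : Type*} [DecidableEq V] (G : SimpleGraph V) [DecidableRel G.Adj]
    (S : Finset V) : Decidable (G.CompleteOn S) := by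
  unfold CompleteOn; infer_instance

instance {V : Type*} [DecidableEq V] (G : SimpleGraph V) [DecidableRel G.Adj]
    (S : Finset V) (c : V) : Decidable (G.StarOn S c) := by
  unfold StarOn; infer_instance

instance {V : Type*} [DecidableEq V] (G : SimpleGraph V) [DecidableRel G.Adj]
    (S : Finset V) (a b : V) : Decidable (G.NearCompleteOn S a b) := by
  unfold NearCompleteOn; infer_instance

instance {V : Type*} [DecidableEq V] (G : SimpleGraph V) [DecidableRel G.Adj]
    (S : Finset V) (c p : V) : Decidable (G.PendantOn S c p) := by
  unfold PendantOn; infer_instance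

instance {V : Type*} [Fintype V] [DecidableEq V] (G : SimpleGraph V) [DecidableRel G.Adj]
    (S : Finset V) : Decidable (G.ExceptionalOn S) := by
  unfold ExceptionalOn; infer_instance

/-- The choices of two disjoint pairs of vertices of a graph on five vertices, each followed by the
remaining vertex. -/
def fivePairs : List (Fin 5 × Fin 5 × Fin 5 × Fin 5 × Fin 5) :=
  [(0, 1, 2, 3, 4), (0, 2, 1, 3, 4), (0, 3, 1, 2, 4), (0, 1, 2, 4, 3), (0, 2, 1, 4, 3),
    (0, 4, 1, 2, 3), (0, 1, 3, 4, 2), (0, 3, 1, 4, 2), (0, 4, 1, 3, 2), (0, 2, 3, 4, 1),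
    (0, 3, 2, 4, 1), (0, 4, 2, 3, 1), (1, 2, 3, 4, 0), (1, 3, 2, 4, 0), (1, 4, 2, 3, 0)]

/-- The choices of three vertices of a graph on five vertices, each followed by the remaining two
vertices. -/
def fiveTriples : List (Fin 5 × Fin 5 × Fin 5 × Fin 5 × Fin 5) :=
  [(0, 1, 2, 3, 4), (0, 1, 3, 2, 4), (0, 1, 4, 2, 3), (0, 2, 3, 1, 4), (0, 2, 4, 1, 3),
    (0, 3, 4, 1, 2), (1, 2, 3, 0, 4), (1, 2, 4, 0, 3), (1, 3, 4, 0, 2), (2, 3, 4, 0, 1)]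

/-- A check of 3·7·15 = 315 labelled graphs, since each new vertex needs an earlier neighbour.
Explicit pairs, triples and witnesses replace the quantifiers of `Contractible` to keep the
evaluation small. -/
theorem fiveGraph_contractible_or_exceptional :
    ∀ b₀₂ b₁₂ : Bool, (b₀₂ || b₁₂) = true →
    ∀ b₀₃ b₁₃ b₂₃ : Bool, (b₀₃ || b₁₃ || b₂₃) = true →
    ∀ b₀₄ b₁₄ b₂₄ b₃₄ : Bool, (b₀₄ || b₁₄ || b₂₄ || b₃₄) = true →
    (∃ t ∈ fivePairs, (fiveGraph true b₀₂ b₁₂ b₀₃ b₁₃ b₂₃ b₀₄ b₁₄ b₂₄ b₃₄).TwoPairsWith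
      t.1 t.2.1 t.2.2.1 t.2.2.2.1 t.2.2.2.2) ∨
    (∃ t ∈ fiveTriples, (fiveGraph true b₀₂ b₁₂ b₀₃ b₁₃ b₂₃ b₀₄ b₁₄ b₂₄ b₃₄).TripleWith
      t.1 t.2.1 t.2.2.1 t.2.2.2.1 t.2.2.2.2) ∨
    (fiveGraph true b₀₂ b₁₂ b₀₃ b₁₃ b₂₃ b₀₄ b₁₄ b₂₄ b₃₄).ExceptionalOn Finset.univ := by
  decide +kernel

open Classical in
theorem exists_eq_fiveGraph (H : SimpleGraph (Fin 5)) :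
    H = fiveGraph (decide (H.Adj 0 1)) (decide (H.Adj 0 2)) (decide (H.Adj 1 2))
      (decide (H.Adj 0 3)) (decide (H.Adj 1 3)) (decide (H.Adj 2 3)) (decide (H.Adj 0 4))
      (decide (H.Adj 1 4)) (decide (H.Adj 2 4)) (decide (H.Adj 3 4)) := by
  ext i j
  fin_cases i <;> fin_cases j <;> simp [fiveGraph] <;> exact H.adj_comm _ _

/-- A graph on five vertices, each but the first adjacent to an earlier one, is contractible or
exceptional. -/
theorem contractible_or_exceptionalOn_univ (H : SimpleGraph (Fin 5)) (h₁ : H.Adj 0 1)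
    (h₂ : H.Adj 0 2 ∨ H.Adj 1 2) (h₃ : H.Adj 0 3 ∨ H.Adj 1 3 ∨ H.Adj 2 3)
    (h₄ : H.Adj 0 4 ∨ H.Adj 1 4 ∨ H.Adj 2 4 ∨ H.Adj 3 4) :
    H.Contractible ∨ H.ExceptionalOn Finset.univ := by
  classical
  have key := fiveGraph_contractible_or_exceptional (decide (H.Adj 0 2)) (decide (H.Adj 1 2))
    (by simpa using h₂) (decide (H.Adj 0 3)) (decide (H.Adj 1 3)) (decide (H.Adj 2 3))
    (by simpa [or_assoc] using h₃) (decide (H.Adj 0 4)) (decide (H.Adj 1 4)) (decide (H.Adj 2 4))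
    (decide (H.Adj 3 4)) (by simpa [or_assoc] using h₄)
  have hH := exists_eq_fiveGraph H
  rw [decide_eq_true h₁] at hH
  rw [← hH] at key
  rcases key with ⟨t, -, h⟩ | ⟨t, -, h⟩ | h
  · exact Or.inl h.contractible
  · exact Or.inl h.contractible
  · exact Or.inr h

end Five

/-! ### The dichotomy for connected graphs -/

section Connected

variable {V : Type*} [Fintype V] [DecidableEq V] {G : SimpleGraph V}

/-- A connected graph contains five vertices, each but the first adjacent to an earlier one. -/
theorem Connected.exists_five (hG : G.Connected) (hV : 5 ≤ Fintype.card V) :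
    ∃ f : Fin 5 ↪ V, G.Adj (f 0) (f 1) ∧ (G.Adj (f 0) (f 2) ∨ G.Adj (f 1) (f 2)) ∧
      (G.Adj (f 0) (f 3) ∨ G.Adj (f 1) (f 3) ∨ G.Adj (f 2) (f 3)) ∧
      (G.Adj (f 0) (f 4) ∨ G.Adj (f 1) (f 4) ∨ G.Adj (f 2) (f 4) ∨ G.Adj (f 3) (f 4)) := by
  have step : ∀ S : Finset V, S.Nonempty → S.card ≤ 4 → ∃ x ∉ S, ∃ y ∈ S, G.Adj y x := by
    intro S hne hS
    obtain ⟨x, hx, y, hy, h⟩ := hG.exists_adj_notMem hne (by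
      rintro rfl
      rw [Finset.card_univ] at hS
      omega)
    exact ⟨x, hx, y, hy, h.symm⟩
  obtain ⟨v₀⟩ := hG.nonempty
  obtain ⟨v₁, h₁, y₁, hy₁, e₁⟩ := step {v₀} (by simp) (by simp)
  obtain ⟨v₂, h₂, y₂, hy₂, e₂⟩ := step {v₀, v₁} (by simp) (Finset.card_le_two.trans (by simp))
  obtain ⟨v₃, h₃, y₃, hy₃, e₃⟩ := step {v₀, v₁, v₂} (by simp)
    (Finset.card_le_three.trans (by simp))
  obtain ⟨v₄, h₄, y₄, hy₄, e₄⟩ := step {v₀, v₁, v₂, v₃} (by simp) Finset.card_le_four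
  simp only [Finset.mem_insert, Finset.mem_singleton, not_or] at *
  have hinj : Function.Injective ![v₀, v₁, v₂, v₃, v₄] := by
    intro i j hij
    fin_cases i <;> fin_cases j <;> simp_all
  refine ⟨⟨_, hinj⟩, ?_⟩
  change G.Adj v₀ v₁ ∧ (G.Adj v₀ v₂ ∨ G.Adj v₁ v₂) ∧
    (G.Adj v₀ v₃ ∨ G.Adj v₁ v₃ ∨ G.Adj v₂ v₃) ∧
    (G.Adj v₀ v₄ ∨ G.Adj v₁ v₄ ∨ G.Adj v₂ v₄ ∨ G.Adj v₃ v₄)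
  clear hinj
  refine ⟨hy₁ ▸ e₁, ?_, ?_, ?_⟩
  · rcases hy₂ with rfl | rfl <;> simp [e₂]
  · rcases hy₃ with rfl | rfl | rfl <;> simp [e₃]
  · rcases hy₄ with rfl | rfl | rfl | rfl <;> simp [e₄]

theorem Connected.contractible_or_exceptionalOn (hG : G.Connected) (hV : 5 ≤ Fintype.card V) :
    G.Contractible ∨ G.ExceptionalOn Finset.univ := by
  obtain ⟨f, h₁, h₂, h₃, h₄⟩ := hG.exists_five hV
  let e : G.comap f ↪g G := Embedding.comap f G
  rcases contractible_or_exceptionalOn_univ (G.comap f) h₁ h₂ h₃ h₄ with h | h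
  · exact Or.inl (h.map e)
  · exact (h.map e).univ_of_connected hG (by simp)

end Connected

/-! ### The dimension of the exceptional families -/

section Values

variable {V : Type*} [Fintype V] [DecidableEq V] {G : SimpleGraph V}

theorem CompleteOn.domPartitionDim_eq (h : G.CompleteOn Finset.univ) (hG : G.Connected)
    [Nontrivial V] : G.domPartitionDim = Fintype.card V := by
  refine le_antisymm (domPartitionDim_le_card hG) (le_domPartitionDim hG fun P hP => ?_)
  obtain ⟨c⟩ := hG.nonempty
  simp only [CompleteOn, Finset.mem_univ, true_imp_iff] at h
  exact card_le_card_parts_of_injOn P fun u _ v _ huv =>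
    hP.part_ne_of_twins (c := c) (by grind) huv (by grind)

/-- Leaves are twins, and domination keeps each leaf out of the part of its only neighbour `c`;
every part is a singleton. -/
theorem StarOn.domPartitionDim_eq {c : V} (h : G.StarOn Finset.univ c) (hG : G.Connected)
    [Nontrivial V] : G.domPartitionDim = Fintype.card V := by
  refine le_antisymm (domPartitionDim_le_card hG) (le_domPartitionDim hG fun P hP => ?_)
  simp only [StarOn, Finset.mem_univ, true_imp_iff, true_and] at h
  have hc : ∀ v, v ≠ c → P.part v ≠ P.part c := by
    intro v hv
    obtain ⟨w, hw, hvw⟩ := hP.exists_adj_part_ne v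
    grind
  refine card_le_card_parts_of_injOn P fun u _ v _ huv => ?_
  by_cases hu : u = c
  · exact hu ▸ (hc v (hu ▸ huv.symm)).symm
  by_cases hv : v = c
  · exact hv ▸ hc u hu
  exact hP.part_ne_of_twins (c := c) (by grind) huv (by grind)

theorem card_sub_one_le_card_parts (P : Finpartition (Finset.univ : Finset V)) (a : V)
    (h : ∀ u v, u ≠ a → v ≠ a → u ≠ v → P.part u ≠ P.part v) :
    Fintype.card V - 1 ≤ P.parts.card := by
  rw [← Finset.card_univ, ← Finset.card_erase_of_mem (Finset.mem_univ a)]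
  exact card_le_card_parts_of_injOn P fun u hu v hv huv =>
    h u v (Finset.ne_of_mem_erase hu) (Finset.ne_of_mem_erase hv) huv

/-- Merging two vertices that a third one separates and that have other neighbours gives an
RD-partition. -/
theorem domPartitionDim_le_card_sub_one (hG : G.Connected) [Nontrivial V] {a b w x y : V}
    (hab : a ≠ b) (hw : w ≠ a ∧ w ≠ b ∧ ¬ (G.Adj a w ↔ G.Adj b w)) (hx : x ≠ b ∧ G.Adj a x)
    (hy : y ≠ a ∧ G.Adj b y) : G.domPartitionDim ≤ Fintype.card V - 1 := by
  let f : V → V := fun v => if v = b then a else v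
  have hcard : (Finset.univ.image f).card ≤ Fintype.card V - 1 := by
    rw [← Finset.card_univ, ← Finset.card_erase_of_mem (Finset.mem_univ b)]
    refine Finset.card_le_card fun z hz => ?_
    obtain ⟨v, -, rfl⟩ := Finset.mem_image.mp hz
    simp only [f, Finset.mem_erase, Finset.mem_univ, and_true]
    grind
  refine (domPartitionDim_le_card_image f ?_ ?_).trans hcard
  · intro u v huv hf
    have hfw : ∀ z, f z = f w ↔ z = w := fun z => by simp only [f]; grind
    refine ⟨w, ?_, ?_⟩
    · simp only [f] at hf ⊢; grind
    · simp only [hfw, exists_eq_left]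
      simp only [f] at hf
      grind
  · intro u
    obtain ⟨z, hz⟩ := hG.preconnected.exists_adj_of_nontrivial u
    have := hz.ne
    by_cases hua : u = a
    · have := hx.2.ne
      exact ⟨x, by simp only [f]; grind, by grind⟩
    by_cases hub : u = b
    · have := hy.2.ne
      exact ⟨y, by simp only [f]; grind, by grind⟩
    exact ⟨z, by simp only [f]; grind, hz⟩

/-- Both `{a, b}` and its complement consist of twins, so a merge joins `a` or `b` to a universal
vertex. The two possible merges exclude each other, so dropping `a` or `b` leaves vertices in
distinct parts. -/
theorem NearCompleteOn.domPartitionDim_eq {a b : V} (h : G.NearCompleteOn Finset.univ a b)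
    (hG : G.Connected) (hV : 5 ≤ Fintype.card V) :
    G.domPartitionDim = Fintype.card V - 1 := by
  have : Nontrivial V := Fintype.one_lt_card_iff_nontrivial.mp (by omega)
  have hV' : 5 ≤ (Finset.univ : Finset V).card := hV
  obtain ⟨q, -, hqa, hqb, -⟩ := exists_mem_ne_of_five_le_card hV' a b a b
  obtain ⟨r, -, hra, hrb, hrq, -⟩ := exists_mem_ne_of_five_le_card hV' a b q q
  simp only [NearCompleteOn, Finset.mem_univ, true_imp_iff, true_and] at h
  obtain ⟨hab, h⟩ := h
  refine le_antisymm ?_ (le_domPartitionDim hG fun P hP => ?_)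
  · apply domPartitionDim_le_card_sub_one hG (a := a) (b := q) (w := b) (x := r) (y := r) <;> grind
  · have hq : ∀ v, v ≠ q → G.Adj v q := by grind
    have twins : ∀ u v, u ≠ v → (u = a ∨ u = b ↔ v = a ∨ v = b) → P.part u ≠ P.part v :=
      fun u v huv huv' => hP.part_ne_of_twins hq huv (by grind)
    by_cases ha : ∃ v, v ≠ a ∧ P.part v = P.part a
    · obtain ⟨v, hva, hv⟩ := ha
      refine card_sub_one_le_card_parts P a ?_
      have hb : ∀ u, u ≠ b → u ≠ a → P.part u ≠ P.part b := by
        intro u hub hua hu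
        have hvb : v ≠ b := fun hvb => twins v a hva (by simp [hvb]) hv
        have huv : u ≠ v := fun h' => twins a b hab (by simp) (by rw [← hv, ← hu, h'])
        obtain ⟨S, hS, haS, hvS, hne⟩ := hP.exists_part_of_universal hq hva.symm hv.symm
        -- The universal vertex `v` sees every part. Only the part of `b` could miss `a`, but it
        -- contains `u`, a neighbour of `a`.
        refine hne (iff_of_true ?_ ?_)
        · by_cases hbS : b ∈ S
          · have : u ∈ S := by rwa [← P.part_eq_iff_mem hS, hu, P.part_eq_iff_mem hS]
            exact ⟨u, this, by grind⟩
          · obtain ⟨w, hw⟩ := P.nonempty_of_mem_parts hS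
            exact ⟨w, hw, by grind⟩
        · obtain ⟨w, hw⟩ := P.nonempty_of_mem_parts hS
          exact ⟨w, hw, by grind⟩
      intro u v hua hva huv
      by_cases hu : u = b
      · exact hu ▸ (hb v (hu ▸ huv.symm) hva).symm
      by_cases hv : v = b
      · exact hv ▸ hb u hu hua
      exact twins u v huv (by simp [*])
    · push Not at ha
      refine card_sub_one_le_card_parts P b fun u v hub hvb huv => ?_
      by_cases hu : u = a
      · exact hu ▸ (ha v (hu ▸ huv.symm)).symm
      by_cases hv : v = a
      · exact hv ▸ ha u hu
      exact twins u v huv (by simp [*])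

/-- The clique vertices other than `c` are twins, and domination separates `p` from `c`. So `p` and
`c` can each share a part only with a clique vertex, and they cannot both do so. -/
theorem PendantOn.domPartitionDim_eq {c p : V} (h : G.PendantOn Finset.univ c p)
    (hG : G.Connected) (hV : 5 ≤ Fintype.card V) :
    G.domPartitionDim = Fintype.card V - 1 := by
  have : Nontrivial V := Fintype.one_lt_card_iff_nontrivial.mp (by omega)
  have hV' : 5 ≤ (Finset.univ : Finset V).card := hV
  obtain ⟨q, -, hqc, hqp, -⟩ := exists_mem_ne_of_five_le_card hV' c p c p
  obtain ⟨r, -, hrc, hrp, hrq, -⟩ := exists_mem_ne_of_five_le_card hV' c p q q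
  simp only [PendantOn, Finset.mem_univ, true_imp_iff, true_and] at h
  obtain ⟨hcp, h⟩ := h
  refine le_antisymm ?_ (le_domPartitionDim hG fun P hP => ?_)
  · apply domPartitionDim_le_card_sub_one hG (a := p) (b := q) (w := r) (x := c) (y := c) <;> grind
  · have hc : ∀ v, v ≠ c → G.Adj v c := by grind
    have twins : ∀ u v, u ≠ c → u ≠ p → v ≠ c → v ≠ p → u ≠ v → P.part u ≠ P.part v :=
      fun u v _ _ _ _ huv => hP.part_ne_of_twins hc huv (by grind)
    have hpc : P.part p ≠ P.part c := by
      obtain ⟨w, hw, hpw⟩ := hP.exists_adj_part_ne p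
      grind
    by_cases hp : ∃ v, v ≠ p ∧ P.part v = P.part p
    · obtain ⟨v, hvp, hv⟩ := hp
      refine card_sub_one_le_card_parts P p ?_
      have hc' : ∀ u, u ≠ c → u ≠ p → P.part u ≠ P.part c := by
        intro u huc hup hu
        have hvc : v ≠ c := fun hvc => hpc (by rw [← hv, hvc])
        have huv : u ≠ v := fun h' => hpc (by rw [← hv, ← hu, h'])
        obtain ⟨S, hS, huS, hcS, hne⟩ := hP.exists_part_of_universal hc huc hu
        obtain ⟨w, hw⟩ := P.nonempty_of_mem_parts hS
        -- Only a part equal to `{p}` could separate `u` from the universal vertex `c`, but the part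
        -- of `p` also contains `v`, a neighbour of `u`.
        refine hne (iff_of_true ?_ ⟨w, hw, by grind⟩)
        by_cases hpS : p ∈ S
        · have : v ∈ S := by rwa [← P.part_eq_iff_mem hS, hv, P.part_eq_iff_mem hS]
          exact ⟨v, this, by grind⟩
        · exact ⟨w, hw, by grind⟩
      intro u v hup hvp huv
      by_cases hu : u = c
      · exact hu ▸ (hc' v (hu ▸ huv.symm) hvp).symm
      by_cases hv : v = c
      · exact hv ▸ hc' u hu hup
      exact twins u v hu hup hv hvp huv
    · push Not at hp
      refine card_sub_one_le_card_parts P c fun u v huc hvc huv => ?_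
      by_cases hu : u = p
      · exact hu ▸ (hp v (hu ▸ huv.symm)).symm
      by_cases hv : v = p
      · exact hv ▸ hp u hu
      exact twins u v huc hu hvc hv huv

end Values

/-! ### From labelled families to isomorphism with the model graphs -/

section Isomorphisms

theorem exists_equiv_apply_eq {V W : Type*} [DecidableEq W] (e : V ≃ W) {a b : V} {c d : W}
    (hab : a ≠ b) (hcd : c ≠ d) : ∃ e' : V ≃ W, e' a = c ∧ e' b = d := by
  let e₁ := e.trans (Equiv.swap (e a) c)
  have h₁ : e₁ a = c := by simp [e₁]
  refine ⟨e₁.trans (Equiv.swap (e₁ b) d), ?_, by simp⟩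
  have : c ≠ e₁ b := fun h => hab (e₁.injective (h₁.trans h))
  simp [h₁, Equiv.swap_apply_of_ne_of_ne this hcd]

variable {V W : Type*} [Fintype V] [Fintype W] {G : SimpleGraph V} {H : SimpleGraph W}

theorem map_univ_iso (e : H ≃g G) :
    Finset.univ.map e.toEmbedding.toEmbedding = (Finset.univ : Finset V) :=
  Finset.map_univ_equiv e.toEquiv

theorem CompleteOn.nonempty_iso_iff (hH : H.CompleteOn Finset.univ)
    (hcard : Fintype.card V = Fintype.card W) :
    Nonempty (G ≃g H) ↔ G.CompleteOn Finset.univ := by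
  constructor
  · rintro ⟨e⟩
    exact map_univ_iso e.symm ▸ hH.map e.symm.toEmbedding
  · intro hG
    refine ⟨⟨Fintype.equivOfCardEq hcard, fun {u v} => ?_⟩⟩
    simp only [CompleteOn, Finset.mem_univ, true_imp_iff] at hG hH
    simp [hG, hH]

theorem StarOn.nonempty_iso_iff {c : W} (hH : H.StarOn Finset.univ c)
    (hcard : Fintype.card V = Fintype.card W) :
    Nonempty (G ≃g H) ↔ ∃ c, G.StarOn Finset.univ c := by
  classical
  constructor
  · rintro ⟨e⟩
    exact ⟨_, map_univ_iso e.symm ▸ hH.map e.symm.toEmbedding⟩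
  · rintro ⟨c', hG⟩
    let e₀ : V ≃ W := Fintype.equivOfCardEq hcard
    let e : V ≃ W := e₀.trans (Equiv.swap (e₀ c') c)
    have he : e c' = c := by simp [e]
    refine ⟨⟨e, fun {u v} => ?_⟩⟩
    simp only [StarOn, Finset.mem_univ, true_imp_iff, true_and] at hG hH
    rw [hG, hH, ← he, e.injective.ne_iff, e.injective.eq_iff, e.injective.eq_iff]

theorem NearCompleteOn.nonempty_iso_iff {a b : W} (hH : H.NearCompleteOn Finset.univ a b)
    (hcard : Fintype.card V = Fintype.card W) :
    Nonempty (G ≃g H) ↔ ∃ a b, G.NearCompleteOn Finset.univ a b := by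
  classical
  constructor
  · rintro ⟨e⟩
    exact ⟨_, _, map_univ_iso e.symm ▸ hH.map e.symm.toEmbedding⟩
  · rintro ⟨a', b', hG⟩
    obtain ⟨e, rfl, rfl⟩ :=
      exists_equiv_apply_eq (Fintype.equivOfCardEq hcard) hG.2.2.1 hH.2.2.1
    refine ⟨⟨e, fun {u v} => ?_⟩⟩
    simp only [NearCompleteOn, Finset.mem_univ, true_imp_iff, true_and] at hG hH
    rw [hG.2, hH.2]
    simp only [e.injective.ne_iff, e.injective.eq_iff]

theorem PendantOn.nonempty_iso_iff {c p : W} (hH : H.PendantOn Finset.univ c p)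
    (hcard : Fintype.card V = Fintype.card W) :
    Nonempty (G ≃g H) ↔ ∃ c p, G.PendantOn Finset.univ c p := by
  classical
  constructor
  · rintro ⟨e⟩
    exact ⟨_, _, map_univ_iso e.symm ▸ hH.map e.symm.toEmbedding⟩
  · rintro ⟨c', p', hG⟩
    obtain ⟨e, rfl, rfl⟩ :=
      exists_equiv_apply_eq (Fintype.equivOfCardEq hcard) hG.2.2.1 hH.2.2.1
    refine ⟨⟨e, fun {u v} => ?_⟩⟩
    simp only [PendantOn, Finset.mem_univ, true_imp_iff, true_and] at hG hH
    rw [hG.2, hH.2]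
    simp only [e.injective.ne_iff, e.injective.eq_iff]

theorem completeOn_completeGraph (n : ℕ) : (completeGraph (Fin n)).CompleteOn Finset.univ := by
  simp [CompleteOn]

theorem starOn_completeBipartiteGraph (n : ℕ) :
    (completeBipartiteGraph (Fin 1) (Fin n)).StarOn Finset.univ (Sum.inl 0) := by
  refine ⟨Finset.mem_univ _, ?_⟩
  rintro (u | u) - (v | v) - <;> simp [completeBipartiteGraph, Fin.fin_one_eq_zero]

theorem nearCompleteOn_graphJoin (n : ℕ) :
    (graphJoin (completeGraph (Fin n)) (completeGraph (Fin 2))ᶜ).NearCompleteOn Finset.univ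
      (Sum.inr 0) (Sum.inr 1) := by
  refine ⟨Finset.mem_univ _, Finset.mem_univ _, by simp, ?_⟩
  rintro (u | u) - (v | v) -
  · simp [graphJoin]
  · simp [graphJoin]
  · simp [graphJoin]
  · fin_cases u <;> fin_cases v <;> simp [graphJoin]

theorem pendantOn_graphJoin (n : ℕ) :
    (graphJoin (completeGraph (Fin 1)) (completeGraph (Fin 1) ⊕g completeGraph (Fin n))).PendantOn
      Finset.univ (Sum.inl 0) (Sum.inr (Sum.inl 0)) := by
  refine ⟨Finset.mem_univ _, Finset.mem_univ _, by simp, ?_⟩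
  rintro (u | u | u) - (v | v | v) - <;> simp [graphJoin, Fin.fin_one_eq_zero]

end Isomorphisms

end SimpleGraph

theorem theorem3 {V : Type*} [Fintype V] [DecidableEq V] (G : SimpleGraph V)
    (hG : G.Connected) (n : ℕ) (hcard : Fintype.card V = n) (hn : 6 ≤ n) :
    (G.domPartitionDim = n ↔
      Nonempty (G ≃g SimpleGraph.completeGraph (Fin n)) ∨
      Nonempty (G ≃g completeBipartiteGraph (Fin 1) (Fin (n - 1)))) ∧
    (G.domPartitionDim = n - 1 ↔
      Nonempty (G ≃g SimpleGraph.graphJoin (SimpleGraph.completeGraph (Fin (n - 2)))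
        (SimpleGraph.completeGraph (Fin 2))ᶜ) ∨
      Nonempty (G ≃g SimpleGraph.graphJoin (SimpleGraph.completeGraph (Fin 1))
        (SimpleGraph.completeGraph (Fin 1) ⊕g SimpleGraph.completeGraph (Fin (n - 2))))) := by
  have : Nontrivial V := Fintype.one_lt_card_iff_nontrivial.mp (by omega)
  have hV : 5 ≤ Fintype.card V := by omega
  rw [(SimpleGraph.completeOn_completeGraph n).nonempty_iso_iff (by simp [hcard]),
    (SimpleGraph.starOn_completeBipartiteGraph (n - 1)).nonempty_iso_iff (by simp; omega),
    (SimpleGraph.nearCompleteOn_graphJoin (n - 2)).nonempty_iso_iff (by simp; omega),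
    (SimpleGraph.pendantOn_graphJoin (n - 2)).nonempty_iso_iff (by simp; omega)]
  have hfull : (G.CompleteOn Finset.univ ∨ ∃ c, G.StarOn Finset.univ c) →
      G.domPartitionDim = n := by
    rintro (h | ⟨c, h⟩)
    · rw [h.domPartitionDim_eq hG, hcard]
    · rw [h.domPartitionDim_eq hG, hcard]
  have hpred : ((∃ a b, G.NearCompleteOn Finset.univ a b) ∨
      ∃ c p, G.PendantOn Finset.univ c p) → G.domPartitionDim = n - 1 := by
    rintro (⟨a, b, h⟩ | ⟨c, p, h⟩)
    · rw [h.domPartitionDim_eq hG hV, hcard]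
    · rw [h.domPartitionDim_eq hG hV, hcard]
  have hcases : G.domPartitionDim ≤ n - 2 ∨
      (G.CompleteOn Finset.univ ∨ ∃ c, G.StarOn Finset.univ c) ∨
      ((∃ a b, G.NearCompleteOn Finset.univ a b) ∨ ∃ c p, G.PendantOn Finset.univ c p) := by
    rcases hG.contractible_or_exceptionalOn hV with h | h
    · exact Or.inl (hcard ▸ h.domPartitionDim_le hG)
    · exact Or.inr (or_assoc.mpr h)
  -- The bound on `n` makes the truncated values `n`, `n - 1` and `n - 2` distinct, so each value
  -- leaves only one case.
  refine ⟨⟨fun h => ?_, hfull⟩, ⟨fun h => ?_, hpred⟩⟩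
  · rcases hcases with h' | h' | h'
    · omega
    · exact h'
    · have := hpred h'
      omega
  · rcases hcases with h' | h' | h'
    · omega
    · have := hfull h'
      omega
    · exact h'
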